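/- Let $\mathbb{Z}^-$ denote the set of negative integers, and let $D \subseteq \mathbb{C}\setminus\mathbb{Z}^-$ be a domain (a non-empty connected open set) such that $D\cap(D+1)\neq\emptyset$, i.e. there is a point $z\in D$ with $z-1\in D$. Let $g$ be a meromorphic function on $D$ that solves the functional equation $$A(z)+A(z-1)=\Gamma(z+1),$$ that is, $g(z)+g(z-1)=\Gamma(z+1)$ holds, as an identity of meromorphic functions, on $D\cap(D+1)$. Then $g$ is not a solution of any algebraic differential equation over the field $\mathbb{C}(z)$ of rational functions: for every $n\ge 0$ and every nonzero polynomial $P\in\mathbb{C}(z)[y_0,y_1,\dots,y_n]$, the meromorphic function $P(g,g',\dots,g^{(n)})$ is not identically zero on $D$. -/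

import Mathlib

open Filter

/-- The set of negative integers, as a subset of the complex plane. -/
def negIntegers : Set ℂ := {z | ∃ n : ℤ, n < 0 ∧ z = (n : ℂ)}

/-- The points `z` at which the equation `A(z) + A(z - 1) = Γ(z + 1)` makes sense for a function
on `D`: both `z` and `z - 1` have to lie in `D`. -/
def shiftOverlap (D : Set ℂ) : Set ℂ := {z | z ∈ D ∧ z - 1 ∈ D}

/-- `g` solves `A(z) + A(z - 1) = Γ(z + 1)` on `D`, as an identity between meromorphic functions:
the equation holds at the points of `shiftOverlap D` off a set without accumulation
points in `shiftOverlap D`, so the (meaningless) values of `g` at its poles are ignored. -/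
def SolvesAltFactorialEq (D : Set ℂ) (g : ℂ → ℂ) : Prop :=
  ∀ᶠ z in codiscreteWithin (shiftOverlap D), g z + g (z - 1) = Complex.Gamma (z + 1)

/-- Differential polynomials in one unknown `y` over the field `ℂ(z)` of rational functions:
the variable with index `i` stands for the derivative `y⁽ⁱ⁾`. -/
abbrev DiffPolynomial : Type := MvPolynomial ℕ (RatFunc ℂ)

/-- The value at the point `z` of `P(z, g, g', g'', …)`. -/
noncomputable def DiffPolynomial.evalAt (P : DiffPolynomial) (g : ℂ → ℂ) (z : ℂ) : ℂ :=
  ∑ m ∈ P.support,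
    (P.coeff m).eval (RingHom.id ℂ) z * m.prod fun i k => (iteratedDeriv i g z) ^ k

/-- The meromorphic function `g` on `D` is a solution of some algebraic differential equation over
`ℂ(z)`: there is a nonzero differential polynomial `P` such that the meromorphic function
`P(z, g, g', g'', …)` vanishes on `D`, that is, off a set without accumulation points in `D` (which
absorbs the poles of `g` and of the coefficients of `P`). -/
def SatisfiesADE (D : Set ℂ) (g : ℂ → ℂ) : Prop :=
  ∃ P : DiffPolynomial, P ≠ 0 ∧ ∀ᶠ z in codiscreteWithin D, P.evalAt g z = 0

/-! Suppose `g` is differentially algebraic over `ℂ(z)`. Fix `z` with `z` and `z - 1` in `D` and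
work in the differential field of meromorphic germs at `z`. The germs of `g(w)` and `g(w - 1)` are
both differentially algebraic, and their sum is the germ of `Γ(w + 1)`. They and all their
derivatives are algebraic over one finitely generated extension of `ℂ`, which contains the
independent variable. So the logarithmic derivative of `Γ(w + 1)` and its derivatives are
algebraically dependent over `ℂ` itself
(`IsDifferentiallyAlgebraic.exists_not_algebraicIndependent_logDeriv_add`). Thus the hypothesis
forces an algebraic differential equation with constant coefficients on `ψ = Γ'/Γ`.

That equation is refuted as in Hölder's theorem. By analytic continuation it holds at all positive
integers, where `ψ(w + 1) = ψ(w) + 1/w` makes the sequences `ψ⁽ⁱ⁾(n + 1)` have the rational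
increments `(-1)ⁱ i!/(n + 1)ⁱ⁺¹`. The polynomial relations over `ℂ(z)` between the germs at infinity
of these sequences form a proper ideal, stable under shifting the coefficients and translating the
variables by the increments. If the ideal is nonzero, a minimal element yields a nontrivial
shift-invariant linear combination of the increments equal to `b(z + 1) - b(z)` with `b` rational
(`exists_increment_of_translateHom_stable`). Shift-invariant rational functions are constants, so
such a combination has its only pole at `0`. A difference `b(z + 1) - b(z)` with a pole has at least
two (`div_X_pow_ne_ratShift_sub`), a contradiction. -/

/-! ### Translations of polynomial rings and their stable ideals -/

namespace MvPolynomial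

variable {ι K : Type*} [CommRing K]

/-- The substitution `X i ↦ X i + a i`. -/
noncomputable def translateHom (a : ι → K) : MvPolynomial ι K →ₐ[K] MvPolynomial ι K :=
  aeval fun i => X i + C (a i)

theorem mul_X_mem_restrictSupport {k d : ℕ} {p : MvPolynomial ι K}
    (hp : p ∈ restrictSupport K {m : ι →₀ ℕ | m.degree + k ≤ d}) (i : ι) :
    p * X i ∈ restrictSupport K {m : ι →₀ ℕ | m.degree + k ≤ d + 1} := by
  classical
  rw [mem_restrictSupport_iff] at hp ⊢
  intro m hm
  rw [Finset.mem_coe, support_mul_X, Finset.mem_map] at hm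
  obtain ⟨m', hm', rfl⟩ := hm
  have := hp hm'
  simp only [Set.mem_ofPred_eq] at this ⊢
  simp [Finsupp.degree_single]
  omega

/-- Up to terms of degree smaller by two, a translation acts on a monomial as `1 + ∑ aᵢ ∂ᵢ`. -/
theorem translateHom_monomial_sub [Fintype ι] (a : ι → K) (m : ι →₀ ℕ) (c : K) :
    translateHom a (monomial m c) - monomial m c ∈
        restrictSupport K {s : ι →₀ ℕ | s.degree + 1 ≤ m.degree} ∧
      translateHom a (monomial m c) - monomial m c - ∑ i, C (a i) * pderiv i (monomial m c) ∈
        restrictSupport K {s : ι →₀ ℕ | s.degree + 2 ≤ m.degree} := by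
  classical
  -- The two estimates are proved together: peeling off one variable, the second-order remainder
  -- picks up a multiple of the first-order one.
  induction hn : m.degree generalizing m with
  | zero =>
    obtain rfl : m = 0 := (Finsupp.degree_eq_zero_iff m).1 hn
    simp [translateHom, ← C_apply]
  | succ n ih =>
    have hm : m ≠ 0 := by rintro rfl; simp at hn
    obtain ⟨i, hi⟩ := Finsupp.ne_iff.1 hm
    have hle : Finsupp.single i 1 ≤ m := by
      rw [Finsupp.single_le_iff]; exact Nat.one_le_iff_ne_zero.2 hi
    obtain ⟨m', rfl⟩ : ∃ m', m = m' + Finsupp.single i 1 := ⟨m - Finsupp.single i 1,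
      (tsub_add_cancel_of_le hle).symm⟩
    have hd : m'.degree = n := by simpa [Finsupp.degree_single] using hn
    obtain ⟨h1, h2⟩ := ih m' hd
    have hX : monomial (m' + Finsupp.single i 1) c = monomial m' c * X i := by
      rw [monomial_add_single, pow_one]
    have hT : translateHom a (monomial m' c * X i) =
        translateHom a (monomial m' c) * (X i + C (a i)) := by simp [translateHom]
    have hD : ∑ j, C (a j) * pderiv j (monomial m' c * X i) =
        (∑ j, C (a j) * pderiv j (monomial m' c)) * X i + C (a i) * monomial m' c := by
      simp only [Derivation.leibniz, smul_eq_mul, mul_add, Finset.sum_add_distrib]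
      rw [add_comm]
      congr 1
      · rw [Finset.sum_mul]
        exact Finset.sum_congr rfl fun j _ => by ring
      · rw [Finset.sum_eq_single i]
        · simp
        · intro j _ hj; simp [pderiv_X, hj.symm]
        · simp
    rw [hX, hT, hD]
    have hmon : monomial m' c ∈ restrictSupport K {s : ι →₀ ℕ | s.degree + 1 ≤ n + 1} := by
      rw [mem_restrictSupport_iff]
      intro s hs
      have := support_monomial_subset hs
      simp only [Finset.mem_singleton] at this
      subst this
      simp [hd]
    constructor
    · have e : translateHom a (monomial m' c) * (X i + C (a i)) - monomial m' c * X i =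
          (translateHom a (monomial m' c) - monomial m' c) * X i +
          a i • (translateHom a (monomial m' c) - monomial m' c) + a i • monomial m' c := by
        simp only [smul_eq_C_mul]; ring
      rw [e]
      refine add_mem (add_mem (mul_X_mem_restrictSupport h1 i) (Submodule.smul_mem _ _ ?_))
        (Submodule.smul_mem _ _ hmon)
      refine restrictSupport_mono K ?_ h1
      intro s hs
      simp only [Set.mem_ofPred_eq] at hs ⊢
      omega
    · have e : translateHom a (monomial m' c) * (X i + C (a i)) - monomial m' c * X i -
          ((∑ j, C (a j) * pderiv j (monomial m' c)) * X i + C (a i) * monomial m' c) =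
          (translateHom a (monomial m' c) - monomial m' c -
            ∑ j, C (a j) * pderiv j (monomial m' c)) * X i +
          a i • (translateHom a (monomial m' c) - monomial m' c) := by
        simp only [smul_eq_C_mul]; ring
      rw [e]
      refine add_mem (mul_X_mem_restrictSupport h2 i) (Submodule.smul_mem _ _ ?_)
      refine restrictSupport_mono K ?_ h1
      intro s hs
      simp only [Set.mem_ofPred_eq] at hs ⊢
      omega

theorem translateHom_sub_mem [Fintype ι] (a : ι → K) (p : MvPolynomial ι K) :
    translateHom a p - p ∈
        restrictSupport K {s : ι →₀ ℕ | s.degree + 1 ≤ p.totalDegree} ∧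
      translateHom a p - p - ∑ i, C (a i) * pderiv i p ∈
        restrictSupport K {s : ι →₀ ℕ | s.degree + 2 ≤ p.totalDegree} := by
  have hs : ∀ (k : ℕ), ∀ m ∈ p.support, restrictSupport K {s : ι →₀ ℕ | s.degree + k ≤ m.degree} ≤
      restrictSupport K {s : ι →₀ ℕ | s.degree + k ≤ p.totalDegree} := fun k m hm =>
    restrictSupport_mono K fun s hs => le_trans hs (le_totalDegree hm)
  have e1 : translateHom a p - p =
      ∑ m ∈ p.support, (translateHom a (monomial m (p.coeff m)) - monomial m (p.coeff m)) := by
    conv_lhs => rw [p.as_sum]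
    rw [map_sum, Finset.sum_sub_distrib]
  have e2 : translateHom a p - p - ∑ i, C (a i) * pderiv i p =
      ∑ m ∈ p.support, (translateHom a (monomial m (p.coeff m)) - monomial m (p.coeff m) -
        ∑ i, C (a i) * pderiv i (monomial m (p.coeff m))) := by
    rw [Finset.sum_sub_distrib, ← e1, Finset.sum_comm]
    congr 1
    refine Finset.sum_congr rfl fun i _ => ?_
    conv_lhs => rw [p.as_sum]
    rw [map_sum, Finset.mul_sum]
  constructor
  · rw [e1]
    exact sum_mem fun m hm => hs 1 m hm (translateHom_monomial_sub a m _).1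
  · rw [e2]
    exact sum_mem fun m hm => hs 2 m hm (translateHom_monomial_sub a m _).2

theorem coeff_eq_zero_of_mem_restrictSupport {s : Set (ι →₀ ℕ)} {p : MvPolynomial ι K}
    (hp : p ∈ restrictSupport K s) {m : ι →₀ ℕ} (hm : m ∉ s) : p.coeff m = 0 := by
  by_contra h
  exact hm ((mem_restrictSupport_iff K).1 hp (mem_support_iff.2 h))

theorem coeff_translateHom_of_totalDegree_le [Fintype ι] (a : ι → K) (p : MvPolynomial ι K)
    {m : ι →₀ ℕ} (hm : p.totalDegree ≤ m.degree) : (translateHom a p).coeff m = p.coeff m := by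
  have := coeff_eq_zero_of_mem_restrictSupport (translateHom_sub_mem a p).1 (m := m)
    (by simp only [Set.mem_ofPred_eq]; omega)
  rwa [coeff_sub, sub_eq_zero] at this

theorem coeff_translateHom_of_totalDegree_le_succ [Fintype ι] (a : ι → K) (p : MvPolynomial ι K)
    {m : ι →₀ ℕ} (hm : p.totalDegree ≤ m.degree + 1) :
    (translateHom a p).coeff m = p.coeff m + ∑ i, a i * (pderiv i p).coeff m := by
  have := coeff_eq_zero_of_mem_restrictSupport (translateHom_sub_mem a p).2 (m := m)
    (by simp only [Set.mem_ofPred_eq]; omega)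
  rw [coeff_sub, coeff_sub, sub_sub, sub_eq_zero] at this
  rw [this, coeff_sum]
  simp

end MvPolynomial

open MvPolynomial in
/-- If a proper nonzero ideal of relations is stable under a twisted translation, then some
nontrivial invariant combination of the increments `a i` is itself an increment. -/
theorem exists_increment_of_translateHom_stable {ι K : Type*} [Fintype ι] [Field K] [CharZero K]
    (τ : K →+* K) (a : ι → K) (I : Ideal (MvPolynomial ι K)) (hI : I ≠ ⊤) (hI' : I ≠ ⊥)
    (hstab : ∀ p ∈ I, translateHom a (map τ p) ∈ I) :
    ∃ (c : ι → K) (b : K), c ≠ 0 ∧ (∀ i, τ (c i) = c i) ∧ ∑ i, c i * a i = τ b - b := by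
  classical
  let top : MvPolynomial ι K → Finset (ι →₀ ℕ) :=
    fun p => {m ∈ p.support | m.degree = p.totalDegree}
  -- Minimality is lexicographic: first the total degree, then the number of monomials of top
  -- degree.
  let μ : MvPolynomial ι K → ℕ ×ₗ ℕ := fun p => toLex (p.totalDegree, (top p).card)
  let S : Set (MvPolynomial ι K) := {p | p ∈ I ∧ p ≠ 0}
  have hS : S.Nonempty := (Submodule.ne_bot_iff I).1 hI' |>.imp fun p hp => ⟨hp.1, hp.2⟩
  have wf : WellFounded (fun p q : MvPolynomial ι K => μ p < μ q) := InvImage.wf μ wellFounded_lt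
  obtain ⟨p₀, ⟨hp₀I, hp₀⟩, hmin₀⟩ := wf.has_min S hS
  obtain ⟨m₀, hm₀, hdeg⟩ : ∃ m ∈ p₀.support, m.degree = p₀.totalDegree := by
    obtain ⟨m, hm, h⟩ := Finset.exists_mem_eq_sup p₀.support (support_nonempty.2 hp₀)
      (fun s => s.sum fun _ e => e)
    exact ⟨m, hm, h.symm⟩
  have hc₀ : p₀.coeff m₀ ≠ 0 := mem_support_iff.1 hm₀
  obtain ⟨p, hpdef⟩ : ∃ p, p = C (p₀.coeff m₀)⁻¹ * p₀ := ⟨_, rfl⟩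
  have hsupp : p.support = p₀.support := by
    ext m; simp [hpdef, hc₀]
  have htd : p.totalDegree = p₀.totalDegree := by
    simp only [totalDegree, hsupp]
  have hpI : p ∈ I := hpdef ▸ I.mul_mem_left _ hp₀I
  have hμ : μ p = μ p₀ := by simp only [μ, top, hsupp, htd]
  have hp1 : p.coeff m₀ = 1 := by simp [hpdef, hc₀]
  have hmin : ∀ q ∈ I, q ≠ 0 → ¬ μ q < μ p := fun q hq hq0 => hμ ▸ hmin₀ q ⟨hq, hq0⟩
  have hτ : (map τ p).totalDegree = p.totalDegree := by
    simp only [totalDegree, support_map_of_injective p τ.injective]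
  rw [← htd] at hdeg
  have hcoeff : ∀ m : ι →₀ ℕ, p.totalDegree ≤ m.degree →
      (translateHom a (map τ p)).coeff m = τ (p.coeff m) := fun m hm => by
    rw [coeff_translateHom_of_totalDegree_le a _ (hτ.trans_le hm), coeff_map]
  -- The difference lies in `I`, and translation does not affect top-degree coefficients, so there
  -- it has coefficients `τ c - c`. The normalised coefficient at `m₀` cancels and no new top
  -- monomial appears, so a nonzero difference would contradict minimality.
  have hinv : translateHom a (map τ p) = p := by
    by_contra hne
    have hq : translateHom a (map τ p) - p ≠ 0 := sub_ne_zero.2 hne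
    refine hmin _ (I.sub_mem (hstab p hpI) hpI) hq ?_
    have hcq : ∀ m : ι →₀ ℕ, p.totalDegree ≤ m.degree →
      (translateHom a (map τ p) - p).coeff m = τ (p.coeff m) - p.coeff m := fun m hm => by
        rw [coeff_sub, hcoeff m hm]
    have hle : (translateHom a (map τ p) - p).totalDegree ≤ p.totalDegree := by
      refine Finset.sup_le fun m hm => ?_
      by_contra hlt
      push Not at hlt
      have hlt' : p.totalDegree < m.degree := hlt
      have : p.coeff m = 0 := coeff_eq_zero_of_totalDegree_lt hlt'
      rw [mem_support_iff, hcq m hlt'.le, this, map_zero, sub_zero] at hm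
      exact hm rfl
    rw [Prod.Lex.toLex_lt_toLex]
    rcases hle.lt_or_eq with h | h
    · exact Or.inl h
    · refine Or.inr ⟨h, Finset.card_lt_card ?_⟩
      rw [Finset.ssubset_iff_of_subset]
      · refine ⟨m₀, ?_, ?_⟩
        · simp [top, hdeg, hp1]
        · simp only [top, Finset.mem_filter, mem_support_iff, not_and_or, not_not]
          left
          rw [hcq m₀ hdeg.ge, hp1, map_one, sub_self]
      · intro m hm
        simp only [top, Finset.mem_filter, mem_support_iff] at hm ⊢
        obtain ⟨h1, h2⟩ := hm
        rw [h] at h2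
        refine ⟨fun h0 => h1 ?_, h2⟩
        rw [hcq m h2.ge, h0, map_zero, sub_zero]
  have hfix : ∀ m : ι →₀ ℕ, p.totalDegree ≤ m.degree → τ (p.coeff m) = p.coeff m :=
    fun m hm => by rw [← hcoeff m hm, hinv]
  have hm₀ne : m₀ ≠ 0 := by
    rintro rfl
    have h0 : p.totalDegree = 0 := by simpa using hdeg.symm
    rw [totalDegree_eq_zero_iff_eq_C, hp1] at h0
    exact hI (I.eq_top_iff_one.2 (by simpa [h0] using hpI))
  obtain ⟨j, hj⟩ := Finsupp.ne_iff.1 hm₀ne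
  have hle : Finsupp.single j 1 ≤ m₀ := by
    rw [Finsupp.single_le_iff]; exact Nat.one_le_iff_ne_zero.2 hj
  obtain ⟨m, rfl⟩ : ∃ m, m₀ = m + Finsupp.single j 1 := ⟨m₀ - Finsupp.single j 1,
    (tsub_add_cancel_of_le hle).symm⟩
  have hmd : m.degree + 1 = p.totalDegree := by simpa [Finsupp.degree_single] using hdeg
  -- These are integer multiples of top-degree coefficients of `p`, which `τ` fixes.
  have hci : ∀ i, τ ((pderiv i p).coeff m) = (pderiv i p).coeff m := fun i => by
    rw [coeff_pderiv, map_mul, hfix]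
    · simp
    · simp [Finsupp.degree_single, hmd]
  -- Comparing coefficients at `m`, one degree below the top, in the invariance of `p` gives `p_m =
  -- τ p_m + ∑ aᵢ (∂ᵢp)_m`. The entry at `j` is `m j + 1`, nonzero in characteristic zero.
  refine ⟨fun i => (pderiv i p).coeff m, -p.coeff m, fun h => ?_, hci, ?_⟩
  · have := congrFun h j
    simp only [coeff_pderiv, hp1, one_mul, Pi.zero_apply] at this
    exact Nat.cast_add_one_ne_zero (m j) this
  · have h := coeff_translateHom_of_totalDegree_le_succ a (map τ p) (m := m)
      (by rw [hτ, hmd])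
    rw [hinv, coeff_map] at h
    simp only [pderiv_map, coeff_map, hci] at h
    rw [map_neg]
    simp only [mul_comm (coeff m _)]
    linear_combination -h

/-! ### The shift on rational functions -/

open Polynomial in
/-- The shift `r(z) ↦ r(z + 1)` on rational functions. -/
noncomputable def ratShift : RatFunc ℂ →+* RatFunc ℂ :=
  IsFractionRing.lift (A := ℂ[X])
    (g := (algebraMap ℂ[X] (RatFunc ℂ)).comp (taylorAlgHom (1 : ℂ)).toRingHom)
    ((RatFunc.algebraMap_injective ℂ).comp (taylor_injective (1 : ℂ)))

open Polynomial in
theorem ratShift_algebraMap (p : ℂ[X]) :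
    ratShift (algebraMap ℂ[X] (RatFunc ℂ) p) = algebraMap ℂ[X] (RatFunc ℂ) (taylor 1 p) :=
  IsFractionRing.lift_algebraMap _ p

open Polynomial in
theorem ratShift_eq_num_div_denom (r : RatFunc ℂ) :
    ratShift r = algebraMap ℂ[X] (RatFunc ℂ) (taylor 1 r.num) /
      algebraMap ℂ[X] (RatFunc ℂ) (taylor 1 r.denom) := by
  conv_lhs => rw [← RatFunc.num_div_denom r]
  rw [map_div₀, ratShift_algebraMap, ratShift_algebraMap]

open Polynomial in
theorem RatFunc.eval_num_ne_zero_of_eval_denom_eq_zero {K : Type*} [Field K] (r : RatFunc K) {s : K}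
    (hs : r.denom.eval s = 0) : r.num.eval s ≠ 0 := fun h => by
  obtain ⟨u, v, huv⟩ := RatFunc.isCoprime_num_denom r
  simpa [h, hs] using congrArg (Polynomial.eval s) huv

open Polynomial in
/-- A nonempty set of complex roots cannot be closed under adding a fixed nonzero number. -/
theorem Polynomial.exists_root_add_nsmul_not_root {p : ℂ[X]} (hp : p ≠ 0) {s t : ℂ} (ht : t ≠ 0)
    (hs : p.eval s = 0) : ∃ n : ℕ, p.eval (s + n * t) = 0 ∧ p.eval (s + n * t + t) ≠ 0 := by
  by_contra! h
  have hall : ∀ n : ℕ, p.eval (s + n * t) = 0 := fun n => by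
    induction n with
    | zero => simpa using hs
    | succ n ih => simpa [add_mul, add_assoc] using h n ih
  refine hp (eq_zero_of_infinite_isRoot p (Set.infinite_of_injective_forall_mem
    (f := fun n : ℕ => s + n * t) (fun m n hmn => ?_) hall))
  simpa [ht] using hmn

open Polynomial in
theorem RatFunc.denom_eq_one_of_eval_ne_zero (r : RatFunc ℂ)
    (h : ∀ s, r.denom.eval s ≠ 0) : r.denom = 1 := by
  have hd : r.denom.degree = 0 := by
    by_contra hd
    obtain ⟨s, hs⟩ := IsAlgClosed.exists_root _ hd
    exact h s hs
  exact (RatFunc.monic_denom r).natDegree_eq_zero.1 (natDegree_eq_of_degree_eq_some hd)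

-- The last pole along `s, s + 1, …` would be a pole of `r(z)` but not of `r(z + 1)`, so `r` is a
-- polynomial. The roots of `r - r(0)` are then closed under adding `1`, which forces `r` to be
-- constant.
open Polynomial in
theorem exists_eq_C_of_ratShift_eq {r : RatFunc ℂ} (h : ratShift r = r) :
    ∃ k : ℂ, r = algebraMap ℂ[X] (RatFunc ℂ) (C k) := by
  have hd0 : r.denom ≠ 0 := RatFunc.denom_ne_zero r
  have hpoly : taylor 1 r.num * r.denom = r.num * taylor 1 r.denom := by
    apply RatFunc.algebraMap_injective ℂ
    rw [ratShift_eq_num_div_denom] at h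
    conv_rhs at h => rw [← RatFunc.num_div_denom r]
    rw [div_eq_div_iff] at h
    · simpa only [map_mul] using h
    · simpa [taylor_eq_zero] using hd0
    · simpa using hd0
  have hev : ∀ z, r.num.eval (z + 1) * r.denom.eval z = r.num.eval z * r.denom.eval (z + 1) :=
    fun z => by simpa [taylor_eval] using congrArg (eval z) hpoly
  have hd : r.denom = 1 := by
    refine r.denom_eq_one_of_eval_ne_zero fun s hs => ?_
    obtain ⟨n, h1, h2⟩ := exists_root_add_nsmul_not_root hd0 one_ne_zero hs
    have := hev (s + n * 1)
    rw [h1, mul_zero, eq_comm, mul_eq_zero] at this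
    exact this.elim (r.eval_num_ne_zero_of_eval_denom_eq_zero h1) h2
  refine ⟨r.num.eval 0, ?_⟩
  have hnum : r.num = C (r.num.eval 0) := by
    by_contra hne
    obtain ⟨n, h1, h2⟩ := exists_root_add_nsmul_not_root (sub_ne_zero.2 hne) one_ne_zero
      (s := 0) (by simp)
    have := hev (0 + n * 1)
    simp only [hd, eval_one, mul_one] at this h1 h2
    simp only [eval_sub, eval_C] at h1 h2
    exact h2 (by rw [this]; exact h1)
  conv_lhs => rw [← RatFunc.num_div_denom r, hd, map_one, div_one, hnum]

open Polynomial in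
/-- A rational function whose only pole is at `0` is not of the form `b(z + 1) - b(z)`. -/
theorem div_X_pow_ne_ratShift_sub {r : ℂ[X]} (hr : r.eval 0 ≠ 0) (n : ℕ) (b : RatFunc ℂ) :
    algebraMap ℂ[X] (RatFunc ℂ) r / algebraMap ℂ[X] (RatFunc ℂ) (X ^ (n + 1)) ≠
      ratShift b - b := by
  intro h
  have hd0 : b.denom ≠ 0 := RatFunc.denom_ne_zero b
  have hpoly : X ^ (n + 1) * (taylor 1 b.num * b.denom - taylor 1 b.denom * b.num) =
      r * (taylor 1 b.denom * b.denom) := by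
    apply RatFunc.algebraMap_injective ℂ
    rw [ratShift_eq_num_div_denom] at h
    conv_rhs at h => arg 2; rw [← RatFunc.num_div_denom b]
    rw [div_sub_div, div_eq_div_iff] at h
    · simp only [map_mul, map_sub]
      rw [h]; ring
    · exact (map_ne_zero_iff _ (RatFunc.algebraMap_injective ℂ)).2 (pow_ne_zero _ X_ne_zero)
    · exact mul_ne_zero (by simpa [taylor_eq_zero] using hd0) (by simpa using hd0)
    · simpa [taylor_eq_zero] using hd0
    · simpa using hd0
  have hev : ∀ z, z ^ (n + 1) * (b.num.eval (z + 1) * b.denom.eval z -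
      b.denom.eval (z + 1) * b.num.eval z) = r.eval z * (b.denom.eval (z + 1) * b.denom.eval z) :=
    fun z => by simpa [taylor_eval] using congrArg (eval z) hpoly
  -- From a pole `s` of `b`, the last pole `s + k` to the right is a pole of the difference. So is
  -- `s - l - 1`, where `s - l` is the last pole to the left. Both would have to be `0`. If `b` has
  -- no pole, evaluation at `0` gives the contradiction.
  by_cases hroot : ∃ s, b.denom.eval s = 0
  · obtain ⟨s, hs⟩ := hroot
    obtain ⟨k, h1, h2⟩ := exists_root_add_nsmul_not_root hd0 one_ne_zero hs
    obtain ⟨l, h3, h4⟩ := exists_root_add_nsmul_not_root hd0 (neg_ne_zero.2 one_ne_zero) hs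
    have hk : s + k = 0 := by
      rw [mul_one] at h1 h2
      simpa [h1, h2, b.eval_num_ne_zero_of_eval_denom_eq_zero h1] using hev (s + k)
    have hl : s + l * (-1) + -1 = 0 := by
      have := hev (s + l * (-1) + -1)
      rw [neg_add_cancel_right, h3, zero_mul, zero_mul, mul_zero, sub_zero, mul_eq_zero,
        mul_eq_zero] at this
      refine pow_eq_zero_iff (n.succ_ne_zero) |>.1 (this.resolve_right ?_)
      rintro (h | h)
      exacts [b.eval_num_ne_zero_of_eval_denom_eq_zero h3 h, h4 h]
    have hkl : ((k + l + 1 : ℕ) : ℂ) = 0 := by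
      push_cast; linear_combination hk - hl
    exact absurd hkl (Nat.cast_ne_zero.2 (by omega))
  · push Not at hroot
    have := hev 0
    simp [hr, hroot] at this

open Polynomial in
/-- No nontrivial combination with shift-invariant coefficients of `1/z` and its derivatives is an
increment of a rational function. -/
theorem sum_mul_inverse_powers_ne_ratShift_sub {N : ℕ} {c : Fin N → RatFunc ℂ} (hc : c ≠ 0)
    (hinv : ∀ i, ratShift (c i) = c i) (b : RatFunc ℂ) :
    ∑ i, c i * (algebraMap ℂ[X] (RatFunc ℂ) (C ((-1) ^ (i : ℕ) * (i : ℕ).factorial)) /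
      algebraMap ℂ[X] (RatFunc ℂ) (X ^ ((i : ℕ) + 1))) ≠ ratShift b - b := by
  classical
  choose k hk using fun i => exists_eq_C_of_ratShift_eq (hinv i)
  obtain ⟨i₀, hi₀⟩ := Function.ne_iff.1 hc
  have hk0 : ∀ i, c i ≠ 0 ↔ k i ≠ 0 := fun i => by rw [hk]; simp
  let s : Finset (Fin N) := {i | k i ≠ 0}
  have hs : s.Nonempty := ⟨i₀, by simpa [s] using (hk0 i₀).1 hi₀⟩
  obtain ⟨M, hMs, hM⟩ := s.exists_max_image id hs
  have hkM : k M ≠ 0 := by simpa [s] using hMs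
  have hlt : ∀ i, M < i → k i = 0 := fun i hi => by
    by_contra h
    exact absurd (hM i (by simpa [s] using h)) (not_le.2 hi)
  -- The numerator over the common denominator `X ^ (M + 1)`. Truncated subtraction is harmless,
  -- since `k i = 0` for `i > M`.
  let r : ℂ[X] := ∑ i : Fin N, C (k i * ((-1) ^ (i : ℕ) * (i : ℕ).factorial)) *
    X ^ ((M : ℕ) - (i : ℕ))
  have hr : r.eval 0 ≠ 0 := by
    have : r.eval 0 = k M * ((-1) ^ (M : ℕ) * (M : ℕ).factorial) := by
      simp only [r, eval_finsetSum]
      rw [Finset.sum_eq_single M]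
      · simp
      · intro i _ hi
        rcases lt_or_gt_of_ne hi with h | h
        · have : (M : ℕ) - (i : ℕ) ≠ 0 := Nat.sub_ne_zero_of_lt h
          simp [this]
        · simp [hlt i h]
      · simp
    rw [this]
    exact mul_ne_zero hkM (mul_ne_zero (pow_ne_zero _ (by norm_num))
      (Nat.cast_ne_zero.2 (Nat.factorial_ne_zero _)))
  convert! div_X_pow_ne_ratShift_sub hr M b using 1
  rw [map_sum, Finset.sum_div]
  refine Finset.sum_congr rfl fun i _ => ?_
  rcases le_or_gt i M with h | h
  · have hX : ∀ n : ℕ, algebraMap ℂ[X] (RatFunc ℂ) (X ^ n) ≠ 0 := fun n =>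
      (map_ne_zero_iff _ (RatFunc.algebraMap_injective ℂ)).2 (pow_ne_zero n X_ne_zero)
    rw [hk, ← mul_div_assoc, ← map_mul, ← C_mul, div_eq_div_iff (hX _) (hX _), ← map_mul,
      ← map_mul, mul_assoc, ← pow_add]
    have : (i : ℕ) ≤ M := h
    rw [show (M : ℕ) - i + (i + 1) = M + 1 by omega]
  · simp [hk, hlt i h]

/-! ### Algebraic dependence in differential fields -/

section DifferentialAlgebra

variable {k F : Type*} [Field k] [Field F] [Algebra k F]

theorem IsAlgebraic.adjoin_mono {S T : Set F} (h : S ⊆ T) {x : F}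
    (hx : IsAlgebraic (IntermediateField.adjoin k S) x) :
    IsAlgebraic (IntermediateField.adjoin k T) x :=
  hx.ringHom_of_comp_eq
    (IntermediateField.inclusion (IntermediateField.adjoin.mono k S T h)).toRingHom
    (RingHom.id F) (RingHom.injective _) rfl

/-- A derivation mapping `E` to elements algebraic over `E` preserves algebraicity over `E`. -/
theorem Derivation.isAlgebraic_apply [CharZero k] (δ : Derivation k F F) (E : IntermediateField k F)
    (hE : ∀ x ∈ E, IsAlgebraic E (δ x)) {x : F} (hx : IsAlgebraic E x) : IsAlgebraic E (δ x) := by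
  have : CharZero E := charZero_of_injective_algebraMap (algebraMap k E).injective
  set L := algebraicClosure E F
  set p := minpoly E x
  have hp : Polynomial.aeval x p = 0 := minpoly.aeval E x
  have hsep : Polynomial.aeval x p.derivative ≠ 0 :=
    (minpoly.irreducible hx.isIntegral).separable.aeval_derivative_ne_zero hp
  have hxL : x ∈ L := mem_algebraicClosure_iff.2 hx
  -- The chain rule, with `w` the value at `x` of `q` with differentiated coefficients. For the
  -- minimal polynomial the left side vanishes and separability allows solving for `δ x`.
  have key : ∀ q : Polynomial E, ∃ w ∈ L,
      δ (Polynomial.aeval x q) = w + Polynomial.aeval x q.derivative * δ x := by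
    intro q
    induction q using Polynomial.induction_on' with
    | add q r hq hr =>
      obtain ⟨w, hw, h1⟩ := hq
      obtain ⟨w', hw', h2⟩ := hr
      refine ⟨w + w', add_mem hw hw', ?_⟩
      simp only [map_add, h1, h2]
      ring
    | monomial n c =>
      refine ⟨δ (c : F) * x ^ n,
        mul_mem (mem_algebraicClosure_iff.2 (hE _ c.2)) (pow_mem hxL n), ?_⟩
      simp only [Polynomial.aeval_monomial, Derivation.leibniz, Derivation.leibniz_pow,
        Polynomial.derivative_monomial, smul_eq_mul, nsmul_eq_mul, map_mul]
      have hn : algebraMap E F ((n : ℕ) : E) = n :=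
        _root_.map_natCast (algebraMap E F) n
      have hc : algebraMap E F c = c := rfl
      rw [hn, hc]
      ring
  obtain ⟨w, hw, hδ⟩ := key p
  rw [hp, map_zero] at hδ
  have hδx : δ x = -w / Polynomial.aeval x p.derivative := by
    rw [eq_div_iff hsep]
    linear_combination -hδ
  have hdL : Polynomial.aeval x p.derivative ∈ L := by
    rw [Polynomial.aeval_eq_sum_range]
    exact sum_mem fun i _ => L.smul_mem (pow_mem hxL i)
  rw [hδx]
  exact mem_algebraicClosure_iff.1 (div_mem (neg_mem hw) hdL)

theorem Derivation.isAlgebraic_adjoin_apply [CharZero k] (δ : Derivation k F F) {S : Set F}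
    (hS : ∀ s ∈ S, IsAlgebraic (IntermediateField.adjoin k S) (δ s)) {x : F}
    (hx : IsAlgebraic (IntermediateField.adjoin k S) x) :
    IsAlgebraic (IntermediateField.adjoin k S) (δ x) := by
  have halg : ∀ x ∈ IntermediateField.adjoin k S, IsAlgebraic (IntermediateField.adjoin k S) x :=
    fun x hx => isAlgebraic_algebraMap (⟨x, hx⟩ : IntermediateField.adjoin k S)
  refine δ.isAlgebraic_apply _ (fun x hx => ?_) hx
  induction hx using IntermediateField.adjoin_induction with
  | mem x hx => exact hS x hx
  | algebraMap x => simpa using isAlgebraic_zero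
  | add x y _ _ h1 h2 => simpa using h1.add h2
  | inv x hx h1 =>
    rw [Derivation.leibniz_inv, smul_eq_mul]
    exact ((halg _ hx).inv.pow 2).neg.mul h1
  | mul x y hx hy h1 h2 =>
    rw [Derivation.leibniz, smul_eq_mul, smul_eq_mul]
    exact ((halg _ hx).mul h2).add ((halg _ hy).mul h1)

/-- Infinite sequences algebraic over a finitely generated field are algebraically dependent. -/
theorem not_algebraicIndependent_of_isAlgebraic_adjoin {S : Set F} (hS : S.Finite) {y : ℕ → F}
    (hy : ∀ i, IsAlgebraic (IntermediateField.adjoin k S) (y i)) :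
    ∃ N : ℕ, ¬ AlgebraicIndependent k fun i : Fin N => y i := by
  -- One more element than the rank of the closure of `S` in the algebraic independence matroid can
  -- allow.
  refine ⟨S.ncard + 1, fun h => ?_⟩
  set x := fun i : Fin (S.ncard + 1) => y i
  have hind : (AlgebraicIndependent.matroid k F).Indep (Set.range x) := h.to_subtype_range
  have hsub : Set.range x ⊆ (AlgebraicIndependent.matroid k F).closure S := by
    rw [AlgebraicIndependent.matroid_closure_eq]
    rintro _ ⟨i, rfl⟩
    exact IntermediateField.isAlgebraic_adjoin_iff.1 (hy i)
  have hle := (hind.encard_le_eRk_of_subset hsub).trans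
    ((Matroid.eRk_closure_eq _ _).le.trans (Matroid.eRk_le_encard _ _))
  rw [← Set.image_univ, h.injective.encard_image, Set.encard_univ, ← hS.cast_ncard_eq] at hle
  simp only [ENat.card_eq_coe_fintype_card, Fintype.card_fin, Nat.cast_le] at hle
  omega

/-- Otherwise every initial segment is independent by induction, and each finite set of indices lies
in an initial segment. -/
theorem exists_isAlgebraic_adjoin_image_Iio {R A : Type*} [CommRing R] [CommRing A] [Algebra R A]
    (hinj : Function.Injective (algebraMap R A)) {y : ℕ → A} (h : ¬ AlgebraicIndependent R y) :
    ∃ n, IsAlgebraic (Algebra.adjoin R (y '' Set.Iio n)) (y n) := by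
  by_contra! hn
  have hind : ∀ n, AlgebraicIndepOn R y (Set.Iio n) := fun n => by
    induction n with
    | zero =>
      have : IsEmpty (Set.Iio 0) := by simp
      exact algebraicIndependent_empty_type_iff.2 hinj
    | succ n ih =>
      have : Set.Iio (n + 1) = insert n (Set.Iio n) := by ext; simp
      rw [this]
      exact ih.insert (hn n)
  refine h (algebraicIndependent_of_finite_type fun t ht => ?_)
  obtain ⟨n, hn⟩ := ht.bddAbove
  exact (hind (n + 1)).mono fun i hi => Nat.lt_succ_of_le (hn hi)

/-- `u` satisfies an algebraic differential equation over the field `k(z)`. -/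
def IsDifferentiallyAlgebraic (δ : Derivation k F F) (z u : F) : Prop :=
  ∃ n, IsAlgebraic (IntermediateField.adjoin k (insert z ((fun i => δ^[i] u) '' Set.Iio n)))
    (δ^[n] u)

theorem IsDifferentiallyAlgebraic.of_not_algebraicIndependent {R : Type*} [CommRing R] [Algebra R F]
    (hinj : Function.Injective (algebraMap R F)) (δ : Derivation k F F) {z u : F}
    (hR : ∀ r : R, algebraMap R F r ∈ IntermediateField.adjoin k {z})
    (h : ¬ AlgebraicIndependent R fun i => δ^[i] u) : IsDifferentiallyAlgebraic δ z u := by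
  obtain ⟨n, hn⟩ := exists_isAlgebraic_adjoin_image_Iio hinj h
  refine ⟨n, ?_⟩
  set T := (fun i => δ^[i] u) '' Set.Iio n
  set E := IntermediateField.adjoin k (insert z T)
  have hle : (Algebra.adjoin R T).toSubring ≤ E.toSubfield.toSubring := by
    intro x hx
    induction hx using Algebra.adjoin_induction with
    | mem x hx => exact IntermediateField.subset_adjoin k _ (Set.mem_insert_of_mem _ hx)
    | algebraMap r =>
      exact IntermediateField.adjoin.mono k _ _ (Set.singleton_subset_iff.2 (Set.mem_insert z T))
        (hR r)
    | add x y _ _ h1 h2 => exact add_mem h1 h2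
    | mul x y _ _ h1 h2 => exact mul_mem h1 h2
  exact hn.ringHom_of_comp_eq (Subring.inclusion hle : Algebra.adjoin R T →+* E)
    (RingHom.id F) (Subring.inclusion_injective hle) rfl

/-- The logarithmic derivative of a sum of two differentially algebraic elements satisfies an
algebraic differential equation with constant coefficients. -/
theorem IsDifferentiallyAlgebraic.exists_not_algebraicIndependent_logDeriv_add [CharZero k]
    {δ : Derivation k F F} {z u v : F} (hz : δ z = 1) (hu : IsDifferentiallyAlgebraic δ z u)
    (hv : IsDifferentiallyAlgebraic δ z v) :
    ∃ N : ℕ, ¬ AlgebraicIndependent k fun i : Fin N => δ^[i] (δ (u + v) / (u + v)) := by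
  obtain ⟨n, hn⟩ := hu
  obtain ⟨m, hm⟩ := hv
  set A := (fun i => δ^[i] u) '' Set.Iio n
  set B := (fun i => δ^[i] v) '' Set.Iio m
  have hA : insert z A ⊆ insert z (A ∪ B) := Set.insert_subset_insert Set.subset_union_left
  have hB : insert z B ⊆ insert z (A ∪ B) := Set.insert_subset_insert Set.subset_union_right
  -- Including `z` among the generators absorbs the coefficients from `k(z)`, so the dependence
  -- obtained is over `k`. Differentiation keeps the elements of `S` algebraic over `S`, as `δ z =
  -- 1` and `δ^[n] u`, `δ^[m] v` are algebraic.
  set S := insert z (A ∪ B)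
  have hSfin : S.Finite := (((Set.finite_Iio n).image _).union ((Set.finite_Iio m).image _)).insert z
  have hmem : ∀ x ∈ S, IsAlgebraic (IntermediateField.adjoin k S) x := fun x hx =>
    isAlgebraic_algebraMap
      (⟨x, IntermediateField.subset_adjoin k S hx⟩ : IntermediateField.adjoin k S)
  have hmemA : ∀ i ≤ n, IsAlgebraic (IntermediateField.adjoin k S) (δ^[i] u) := fun i hi => by
    rcases hi.lt_or_eq with h | rfl
    · exact hmem _ (hA (Set.mem_insert_of_mem _ ⟨i, h, rfl⟩))
    · exact hn.adjoin_mono hA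
  have hmemB : ∀ i ≤ m, IsAlgebraic (IntermediateField.adjoin k S) (δ^[i] v) := fun i hi => by
    rcases hi.lt_or_eq with h | rfl
    · exact hmem _ (hB (Set.mem_insert_of_mem _ ⟨i, h, rfl⟩))
    · exact hm.adjoin_mono hB
  have hstab : ∀ s ∈ S, IsAlgebraic (IntermediateField.adjoin k S) (δ s) := by
    rintro s (rfl | ⟨i, hi, rfl⟩ | ⟨i, hi, rfl⟩)
    · rw [hz]; exact isAlgebraic_one
    · simpa only [Function.iterate_succ_apply'] using hmemA (i + 1) hi
    · simpa only [Function.iterate_succ_apply'] using hmemB (i + 1) hi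
  have hsum : IsAlgebraic (IntermediateField.adjoin k S) (u + v) :=
    (hmemA 0 n.zero_le).add (hmemB 0 m.zero_le)
  refine not_algebraicIndependent_of_isAlgebraic_adjoin hSfin
    (y := fun i => δ^[i] (δ (u + v) / (u + v))) fun i => ?_
  induction i with
  | zero =>
    rw [Function.iterate_zero, id, div_eq_mul_inv]
    exact (δ.isAlgebraic_adjoin_apply hstab hsum).mul hsum.inv
  | succ i ih =>
    simp only [Function.iterate_succ_apply']
    exact δ.isAlgebraic_adjoin_apply hstab ih

end DifferentialAlgebra

/-! ### The differential field of meromorphic germs -/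

section MeromorphicGerms

open Topology

/-- Germs of meromorphic functions at `z`, as a subring of all germs of functions on punctured
neighbourhoods. -/
def meromorphicGermSubring (z : ℂ) : Subring (Germ (𝓝[≠] z) ℂ) where
  carrier := {x | ∃ f : ℂ → ℂ, MeromorphicAt f z ∧ (f : Germ (𝓝[≠] z) ℂ) = x}
  mul_mem' := by
    rintro _ _ ⟨f, hf, rfl⟩ ⟨g, hg, rfl⟩
    exact ⟨f * g, hf.mul hg, rfl⟩
  one_mem' := ⟨1, .const 1 z, rfl⟩
  add_mem' := by
    rintro _ _ ⟨f, hf, rfl⟩ ⟨g, hg, rfl⟩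
    exact ⟨f + g, hf.add hg, rfl⟩
  zero_mem' := ⟨0, .const 0 z, rfl⟩
  neg_mem' := by
    rintro _ ⟨f, hf, rfl⟩
    exact ⟨-f, hf.neg, rfl⟩

/-- The field of germs of meromorphic functions at `z`. -/
def MeromorphicGerm (z : ℂ) : Type := meromorphicGermSubring z

namespace MeromorphicGerm

variable {z : ℂ}

/-- On a small punctured neighbourhood a meromorphic function is either identically zero or nowhere
zero, so nonzero germs are invertible. -/
theorem isField_meromorphicGermSubring (z : ℂ) : IsField (meromorphicGermSubring z) where
  exists_pair_ne := ⟨0, 1, zero_ne_one⟩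
  mul_comm := mul_comm
  mul_inv_cancel := by
    rintro ⟨_, f, hf, rfl⟩ h
    refine ⟨⟨_, f⁻¹, hf.inv, rfl⟩, Subtype.ext (Germ.coe_eq.2 ?_)⟩
    rcases hf.eventually_eq_zero_or_eventually_ne_zero with h0 | h0
    · exact absurd (Subtype.ext (Germ.coe_eq.2 h0)) h
    · filter_upwards [h0] with w hw
      exact mul_inv_cancel₀ hw

noncomputable instance : Field (MeromorphicGerm z) := (isField_meromorphicGermSubring z).toField

/-- The inclusion of meromorphic germs into all germs. -/
noncomputable def toGerm (z : ℂ) : MeromorphicGerm z →+* Germ (𝓝[≠] z) ℂ := (meromorphicGermSubring z).subtype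

theorem toGerm_injective : Function.Injective (toGerm z) := Subtype.val_injective

/-- The germ of a meromorphic function. -/
noncomputable def of (f : ℂ → ℂ) (hf : MeromorphicAt f z) : MeromorphicGerm z := ⟨f, f, hf, rfl⟩

@[simp] theorem toGerm_of (f : ℂ → ℂ) (hf : MeromorphicAt f z) :
    toGerm z (of f hf) = Germ.coeRingHom (𝓝[≠] z) f := rfl

theorem exists_eq_of (x : MeromorphicGerm z) : ∃ f hf, x = of f hf := by
  obtain ⟨_, f, hf, rfl⟩ := x
  exact ⟨f, hf, rfl⟩

theorem of_eq_of {f g : ℂ → ℂ} {hf : MeromorphicAt f z} {hg : MeromorphicAt g z} :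
    of f hf = of g hg ↔ f =ᶠ[𝓝[≠] z] g :=
  toGerm_injective.eq_iff.symm.trans Germ.coe_eq

theorem of_add_of {f g : ℂ → ℂ} (hf : MeromorphicAt f z) (hg : MeromorphicAt g z) :
    of f hf + of g hg = of (f + g) (hf.add hg) := rfl

theorem of_mul_of {f g : ℂ → ℂ} (hf : MeromorphicAt f z) (hg : MeromorphicAt g z) :
    of f hf * of g hg = of (f * g) (hf.mul hg) := rfl

theorem of_zero : of 0 (.const 0 z) = 0 := rfl

theorem of_div_of {f g : ℂ → ℂ} (hf : MeromorphicAt f z) (hg : MeromorphicAt g z) :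
    of f hf / of g hg = of (f / g) (hf.div hg) := by
  rcases hg.eventually_eq_zero_or_eventually_ne_zero with h0 | h0
  · have h1 : of g hg = 0 := (of_eq_of.2 h0 : of g hg = of 0 (.const 0 z))
    have h2 : of (f / g) (hf.div hg) = of 0 (.const 0 z) := of_eq_of.2 (by
      filter_upwards [h0] with w hw
      simp [hw])
    rw [h1, h2, div_zero, of_zero]
  · have h1 : of g hg ≠ 0 := fun h => by
      obtain ⟨w, hw, hw'⟩ := (h0.and (of_eq_of.1 (h.trans of_zero.symm))).exists
      exact hw hw'
    rw [div_eq_iff h1, of_mul_of, of_eq_of]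
    filter_upwards [h0] with w hw
    simp [hw]

/-- Constants as meromorphic germs. -/
noncomputable def constHom (z : ℂ) : ℂ →+* MeromorphicGerm z where
  toFun c := of (fun _ => c) (.const c z)
  map_one' := rfl
  map_mul' _ _ := rfl
  map_zero' := rfl
  map_add' _ _ := rfl

noncomputable instance : Algebra ℂ (MeromorphicGerm z) := (constHom z).toAlgebra

theorem algebraMap_eq (c : ℂ) :
    algebraMap ℂ (MeromorphicGerm z) c = of (fun _ => c) (.const c z) := rfl

/-- Differentiation of meromorphic germs, as a map. -/
noncomputable def derivFun (x : MeromorphicGerm z) : MeromorphicGerm z :=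
  ⟨Germ.map' deriv (fun _ _ h => h.nhdsNE_deriv) (toGerm z x), by
    obtain ⟨f, hf, rfl⟩ := exists_eq_of x
    exact ⟨deriv f, hf.deriv, rfl⟩⟩

theorem derivFun_of {f : ℂ → ℂ} (hf : MeromorphicAt f z) :
    derivFun (of f hf) = of (deriv f) hf.deriv := rfl

/-- Differentiation of meromorphic germs. -/
noncomputable def deriv (z : ℂ) : Derivation ℂ (MeromorphicGerm z) (MeromorphicGerm z) :=
  { toFun := derivFun
    map_add' := fun x y => by
      obtain ⟨f, hf, rfl⟩ := exists_eq_of x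
      obtain ⟨g, hg, rfl⟩ := exists_eq_of y
      rw [of_add_of, derivFun_of, derivFun_of, derivFun_of, of_add_of, of_eq_of]
      filter_upwards [hf.eventually_analyticAt, hg.eventually_analyticAt] with w h1 h2
      exact deriv_add h1.differentiableAt h2.differentiableAt
    map_smul' := fun c x => by
      obtain ⟨f, hf, rfl⟩ := exists_eq_of x
      simp only [Algebra.smul_def, algebraMap_eq, RingHom.id_apply]
      rw [of_mul_of, derivFun_of, derivFun_of, of_mul_of, of_eq_of]
      filter_upwards [hf.eventually_analyticAt] with w h1
      exact deriv_const_mul c h1.differentiableAt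
    map_one_eq_zero' := (of_eq_of.2 (by rw [deriv_const']; rfl) :
      of (_root_.deriv fun _ => (1 : ℂ)) (MeromorphicAt.const 1 z).deriv = of 0 (.const 0 z))
    leibniz' := fun x y => by
      obtain ⟨f, hf, rfl⟩ := exists_eq_of x
      obtain ⟨g, hg, rfl⟩ := exists_eq_of y
      change derivFun _ = _ • derivFun _ + _ • derivFun _
      rw [of_mul_of, derivFun_of, derivFun_of, derivFun_of, smul_eq_mul, smul_eq_mul, of_mul_of,
        of_mul_of, of_add_of, of_eq_of]
      filter_upwards [hf.eventually_analyticAt, hg.eventually_analyticAt] with w h1 h2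
      rw [deriv_mul h1.differentiableAt h2.differentiableAt]
      simp only [Pi.add_apply, Pi.mul_apply]
      ring }

theorem deriv_of {f : ℂ → ℂ} (hf : MeromorphicAt f z) :
    deriv z (of f hf) = of (_root_.deriv f) hf.deriv := rfl

theorem meromorphicAt_iteratedDeriv {f : ℂ → ℂ} (hf : MeromorphicAt f z) (n : ℕ) :
    MeromorphicAt (iteratedDeriv n f) z := by
  rw [iteratedDeriv_eq_iterate]
  exact hf.iterated_deriv

theorem iterate_deriv_of {f : ℂ → ℂ} (hf : MeromorphicAt f z) (n : ℕ) :
    (deriv z)^[n] (of f hf) = of (iteratedDeriv n f) (meromorphicAt_iteratedDeriv hf n) := by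
  induction n with
  | zero => exact of_eq_of.2 (by simp)
  | succ n ih =>
    rw [Function.iterate_succ_apply', ih, deriv_of, of_eq_of, iteratedDeriv_succ]

/-- The germ of the identity function. -/
noncomputable def var (z : ℂ) : MeromorphicGerm z := of id (.id z)

theorem deriv_var : deriv z (var z) = 1 :=
  (of_eq_of.2 (by rw [deriv_id']) :
    of (_root_.deriv id) (MeromorphicAt.id z).deriv = of (fun _ => 1) (.const 1 z))

open Polynomial in
theorem toGerm_aeval_var_sub (c : ℂ) (p : ℂ[X]) :
    toGerm z (aeval (var z - algebraMap ℂ _ c) p) =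
      Germ.coeRingHom (𝓝[≠] z) fun w => p.eval (w - c) := by
  induction p using Polynomial.induction_on' with
  | add p q hp hq =>
    simp only [map_add, hp, hq, eval_add]
    rfl
  | monomial n a =>
    simp only [aeval_monomial, eval_monomial, map_mul, map_pow, map_sub]
    rfl

open Polynomial in
theorem aeval_var_sub_injective (c : ℂ) :
    Function.Injective (aeval (R := ℂ) (var z - algebraMap ℂ _ c)) := by
  rw [injective_iff_map_eq_zero]
  intro p hp
  by_contra hne
  have h0 : ∀ᶠ w in 𝓝[≠] z, p.eval (w - c) = 0 := by
    have := toGerm_aeval_var_sub (z := z) c p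
    rw [hp, map_zero] at this
    exact Germ.coe_eq.1 this.symm
  have hfin : {w | p.eval (w - c) = 0}.Finite :=
    (finite_setOfPred_isRoot hne).preimage (f := fun w => w - c) (sub_left_injective.injOn)
  obtain ⟨w, h1, h2⟩ := (h0.and (nhdsNE_le_cofinite z hfin.compl_mem_cofinite)).exists
  exact h2 h1

/-- The embedding of the rational functions, `r ↦ r(w - c)`. -/
noncomputable def ratHom (z c : ℂ) : RatFunc ℂ →+* MeromorphicGerm z :=
  IsFractionRing.lift (A := Polynomial ℂ)
    (g := (Polynomial.aeval (R := ℂ) (var z - algebraMap ℂ _ c)).toRingHom)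
    (aeval_var_sub_injective c)

open Polynomial in
theorem ratHom_apply (c : ℂ) (r : RatFunc ℂ) : ratHom z c r =
    aeval (var z - algebraMap ℂ _ c) r.num / aeval (var z - algebraMap ℂ _ c) r.denom := by
  conv_lhs => rw [← RatFunc.num_div_denom r]
  rw [map_div₀]
  congr 1 <;> exact IsFractionRing.lift_algebraMap _ _

theorem toGerm_ratHom (c : ℂ) (r : RatFunc ℂ) : toGerm z (ratHom z c r) =
    Germ.coeRingHom (𝓝[≠] z) fun w => r.eval (RingHom.id ℂ) (w - c) := by
  obtain ⟨f, hf, h1⟩ := exists_eq_of (Polynomial.aeval (var z - algebraMap ℂ _ c) r.num)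
  obtain ⟨g, hg, h2⟩ := exists_eq_of (Polynomial.aeval (var z - algebraMap ℂ _ c) r.denom)
  rw [ratHom_apply, h1, h2, of_div_of, toGerm_of]
  have h3 := toGerm_aeval_var_sub (z := z) c r.num
  have h4 := toGerm_aeval_var_sub (z := z) c r.denom
  rw [h1, toGerm_of] at h3
  rw [h2, toGerm_of] at h4
  refine Germ.coe_eq.2 ?_
  filter_upwards [Germ.coe_eq.1 h3, Germ.coe_eq.1 h4] with w h5 h6
  simp only [Pi.div_apply, h5, h6, RatFunc.eval, Polynomial.eval₂_id]

theorem ratHom_mem_adjoin (c : ℂ) (r : RatFunc ℂ) :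
    ratHom z c r ∈ IntermediateField.adjoin ℂ {var z} := by
  have hZ : var z - algebraMap ℂ _ c ∈ IntermediateField.adjoin ℂ {var z} :=
    sub_mem (IntermediateField.mem_adjoin_simple_self ℂ _) (algebraMap_mem _ c)
  have haeval : ∀ p : Polynomial ℂ, Polynomial.aeval (var z - algebraMap ℂ _ c) p ∈
      IntermediateField.adjoin ℂ {var z} := fun p => by
    rw [Polynomial.aeval_eq_sum_range]
    exact sum_mem fun i _ => IntermediateField.smul_mem _ (pow_mem hZ i)
  rw [ratHom_apply]
  exact div_mem (haeval _) (haeval _)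

/-- A meromorphic function which, up to a translation, satisfies an algebraic differential equation
near `z` has a differentially algebraic germ. -/
theorem isDifferentiallyAlgebraic_of {P : DiffPolynomial} (hP : P ≠ 0) {g : ℂ → ℂ} {c : ℂ}
    (hg : MeromorphicAt (fun w => g (w - c)) z) (h : ∀ᶠ w in 𝓝[≠] z, P.evalAt g (w - c) = 0) :
    IsDifferentiallyAlgebraic (deriv z) (var z) (of (fun w => g (w - c)) hg) := by
  -- The scalars act through `r(w - c)`, matching the translated equation; these germs still lie in
  -- the field generated by `var z`.
  let : Algebra (RatFunc ℂ) (MeromorphicGerm z) := (ratHom z c).toAlgebra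
  refine .of_not_algebraicIndependent (R := RatFunc ℂ) (ratHom z c).injective _
    (ratHom_mem_adjoin c) fun hind => hP (hind.eq_zero_of_aeval_eq_zero P ?_)
  apply toGerm_injective
  rw [MvPolynomial.aeval_def, MvPolynomial.eval₂_eq, map_zero, map_sum]
  have hterm : ∀ m ∈ P.support, toGerm z (algebraMap (RatFunc ℂ) (MeromorphicGerm z) (P.coeff m) *
      ∏ i ∈ m.support, ((deriv z)^[i] (of (fun w => g (w - c)) hg)) ^ m i) =
      Germ.coeRingHom (𝓝[≠] z) ((fun w => (P.coeff m).eval (RingHom.id ℂ) (w - c)) *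
        ∏ i ∈ m.support, (fun w => iteratedDeriv i g (w - c)) ^ m i) := fun m _ => by
    rw [map_mul, map_mul, map_prod, map_prod]
    congr 1
    · exact toGerm_ratHom c _
    · refine Finset.prod_congr rfl fun i _ => ?_
      rw [map_pow, map_pow, iterate_deriv_of, toGerm_of, iteratedDeriv_comp_sub_const]
  rw [Finset.sum_congr rfl hterm, ← map_sum, ← map_zero (Germ.coeRingHom (𝓝[≠] z))]
  refine Germ.coe_eq.2 ?_
  filter_upwards [h] with w hw
  rw [DiffPolynomial.evalAt] at hw
  simpa [Finsupp.prod] using hw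

theorem aeval_iterate_deriv_eq_zero {N : ℕ} {f : ℂ → ℂ} (hf : MeromorphicAt f z)
    {P : MvPolynomial (Fin N) ℂ}
    (h : MvPolynomial.aeval (fun i : Fin N => (deriv z)^[i] (of f hf)) P = 0) :
    ∀ᶠ w in 𝓝[≠] z, MvPolynomial.eval (fun i : Fin N => iteratedDeriv i f w) P = 0 := by
  have h' := congrArg (toGerm z) h
  rw [MvPolynomial.aeval_def, MvPolynomial.eval₂_eq, map_zero, map_sum] at h'
  have hterm : ∀ m ∈ P.support, toGerm z (algebraMap ℂ (MeromorphicGerm z) (P.coeff m) *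
      ∏ i ∈ m.support, ((deriv z)^[i] (of f hf)) ^ m i) =
      Germ.coeRingHom (𝓝[≠] z) ((fun _ => P.coeff m) *
        ∏ i ∈ m.support, iteratedDeriv i f ^ m i) := fun m _ => by
    rw [map_mul, map_mul, map_prod, map_prod]
    congr 1
    refine Finset.prod_congr rfl fun i _ => ?_
    rw [map_pow, map_pow, iterate_deriv_of, toGerm_of]
  rw [Finset.sum_congr rfl hterm, ← map_sum, ← map_zero (Germ.coeRingHom (𝓝[≠] z))] at h'
  filter_upwards [Germ.coe_eq.1 h'] with w hw
  rw [MvPolynomial.eval_eq, ← Pi.zero_apply (M := fun _ : ℂ => ℂ) w, ← hw]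
  simp

end MeromorphicGerm

end MeromorphicGerms

/-! ### Germs of sequences and their polynomial relations -/

section SequenceGerms

/-- The shift `u n ↦ u (n + 1)` on germs of sequences at infinity. -/
def germShift : Germ (atTop : Filter ℕ) ℂ →+* Germ (atTop : Filter ℕ) ℂ where
  toFun x := x.compTendsto (· + 1) (tendsto_add_atTop_nat 1)
  map_one' := rfl
  map_mul' := by rintro ⟨f⟩ ⟨g⟩; rfl
  map_zero' := rfl
  map_add' := by rintro ⟨f⟩ ⟨g⟩; rfl

theorem germShift_coe (f : ℕ → ℂ) :
    germShift (Germ.coeRingHom atTop f) = Germ.coeRingHom atTop fun n => f (n + 1) := rfl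

open Polynomial in
/-- The germ at infinity of the sequence `p (n + 1)`. -/
noncomputable def polynomialGerm : ℂ[X] →+* Germ (atTop : Filter ℕ) ℂ :=
  (Germ.coeRingHom atTop).comp (RingHom.pi fun n : ℕ => evalRingHom ((n : ℂ) + 1))

open Polynomial in
theorem polynomialGerm_apply (p : ℂ[X]) :
    polynomialGerm p = Germ.coeRingHom atTop fun n : ℕ => p.eval ((n : ℂ) + 1) := rfl

open Polynomial in
theorem eventually_eval_ne_zero {p : ℂ[X]} (hp : p ≠ 0) :
    ∀ᶠ n : ℕ in atTop, p.eval ((n : ℂ) + 1) ≠ 0 := by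
  have hfin : {n : ℕ | p.eval ((n : ℂ) + 1) = 0}.Finite :=
    (finite_setOfPred_isRoot hp).preimage (f := fun n : ℕ => (n : ℂ) + 1)
      (fun m _ n _ h => by simpa using h)
  rw [← Nat.cofinite_eq_atTop]
  exact hfin.compl_mem_cofinite

open Polynomial in
theorem isUnit_polynomialGerm (p : nonZeroDivisors ℂ[X]) :
    IsUnit (polynomialGerm (p : ℂ[X])) := by
  refine .of_mul_eq_one (Germ.coeRingHom atTop fun n : ℕ => ((p : ℂ[X]).eval ((n : ℂ) + 1))⁻¹) ?_
  rw [polynomialGerm_apply, ← map_mul, ← map_one (Germ.coeRingHom atTop)]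
  refine Germ.coe_eq.2 ?_
  filter_upwards [eventually_eval_ne_zero (nonZeroDivisors.ne_zero p.2)] with n hn
  exact mul_inv_cancel₀ hn

open Polynomial in
/-- The germ at infinity of the sequence `r (n + 1)`. -/
noncomputable def ratFuncGerm : RatFunc ℂ →+* Germ (atTop : Filter ℕ) ℂ :=
  IsLocalization.lift (M := nonZeroDivisors ℂ[X]) isUnit_polynomialGerm

open Polynomial in
theorem ratFuncGerm_algebraMap (p : ℂ[X]) :
    ratFuncGerm (algebraMap ℂ[X] (RatFunc ℂ) p) = polynomialGerm p :=
  IsLocalization.lift_eq _ p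

open Polynomial in
theorem ratFuncGerm_div (p : ℂ[X]) {q : ℂ[X]} (hq : q ≠ 0) :
    ratFuncGerm (algebraMap ℂ[X] (RatFunc ℂ) p / algebraMap ℂ[X] (RatFunc ℂ) q) =
      Germ.coeRingHom atTop fun n : ℕ => p.eval ((n : ℂ) + 1) / q.eval ((n : ℂ) + 1) := by
  have hu := isUnit_polynomialGerm ⟨q, mem_nonZeroDivisors_of_ne_zero hq⟩
  apply hu.mul_left_injective
  simp only
  rw [← ratFuncGerm_algebraMap, ← map_mul, div_mul_cancel₀ _ (by simpa using hq),
    ratFuncGerm_algebraMap, ratFuncGerm_algebraMap, polynomialGerm_apply, polynomialGerm_apply,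
    ← map_mul]
  refine Germ.coe_eq.2 ?_
  filter_upwards [eventually_eval_ne_zero hq] with n hn
  exact (div_mul_cancel₀ _ hn).symm

open Polynomial in
theorem germShift_comp_ratFuncGerm :
    germShift.comp ratFuncGerm = ratFuncGerm.comp ratShift := by
  refine IsLocalization.ringHom_ext (nonZeroDivisors ℂ[X]) (RingHom.ext fun p => ?_)
  simp only [RingHom.comp_apply, ratShift_algebraMap, ratFuncGerm_algebraMap,
    polynomialGerm_apply, germShift_coe, taylor_eval]
  simp

open MvPolynomial in
/-- Sequences with increments `(-1)ⁱ i! / (n + 1)ⁱ⁺¹` satisfy no polynomial relation. -/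
theorem exists_eval_ne_zero_of_increments {N : ℕ} {y : Fin N → ℕ → ℂ}
    (hy : ∀ i n, y i (n + 1) =
      y i n + (-1) ^ (i : ℕ) * (i : ℕ).factorial / ((n : ℂ) + 1) ^ ((i : ℕ) + 1))
    {P : MvPolynomial (Fin N) ℂ} (hP : P ≠ 0) : ∃ n, eval (fun i => y i n) P ≠ 0 := by
  by_contra! h
  let a : Fin N → RatFunc ℂ := fun i =>
    algebraMap (Polynomial ℂ) (RatFunc ℂ) (.C ((-1) ^ (i : ℕ) * (i : ℕ).factorial)) /
      algebraMap (Polynomial ℂ) (RatFunc ℂ) (.X ^ ((i : ℕ) + 1))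
  let Y : Fin N → Germ (atTop : Filter ℕ) ℂ := fun i => Germ.coeRingHom atTop (y i)
  let Φ := eval₂Hom ratFuncGerm Y
  have hshiftY : ∀ i, germShift (Y i) = Y i + ratFuncGerm (a i) := fun i => by
    simp only [Y, a]
    rw [germShift_coe, ratFuncGerm_div _ (pow_ne_zero _ Polynomial.X_ne_zero), ← map_add]
    congr 1
    funext n
    simp [hy i n]
  -- The twisted translation of a relation evaluates to the shift of its value, so the kernel of `Φ`
  -- is stable.
  have hcomp : (Φ.comp (translateHom a).toRingHom).comp (map ratShift) = germShift.comp Φ := by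
    refine ringHom_ext (fun r => ?_) fun i => ?_
    · have := RingHom.congr_fun germShift_comp_ratFuncGerm r
      simpa [Φ, translateHom] using this.symm
    · simp [Φ, translateHom, hshiftY]
  let κ : ℂ →+* RatFunc ℂ := (algebraMap (Polynomial ℂ) (RatFunc ℂ)).comp Polynomial.C
  have hΦP : Φ (map κ P) = 0 := by
    have e : ∀ Q : MvPolynomial (Fin N) ℂ, Φ (map κ Q) =
        Germ.coeRingHom atTop fun n => eval (fun i => y i n) Q := fun Q => by
      induction Q using MvPolynomial.induction_on with
      | C c =>
        simp only [Φ, κ, map_C, coe_eval₂Hom, eval₂_C, RingHom.comp_apply,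
          ratFuncGerm_algebraMap, polynomialGerm_apply, Polynomial.eval_C, eval_C]
      | add p q hp hq =>
        simp only [map_add, hp, hq]
        rfl
      | mul_X p i hp =>
        simp only [map_mul, hp, map_X, Φ, coe_eval₂Hom, eval₂_X, eval_X]
        rfl
    rw [e]
    simp only [h]
    rfl
  obtain ⟨c, b, hc, hinv, hsum⟩ := exists_increment_of_translateHom_stable ratShift a (RingHom.ker Φ)
    (RingHom.ker_ne_top Φ)
    (fun hbot => hP (map_injective κ κ.injective (by
      rw [map_zero, ← Ideal.mem_bot, ← hbot]
      exact hΦP)))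
    (fun p hp => by
      have := RingHom.congr_fun hcomp p
      simp only [RingHom.comp_apply] at this
      rw [RingHom.mem_ker] at hp ⊢
      rw [hp, map_zero] at this
      exact this)
  exact sum_mul_inverse_powers_ne_ratShift_sub hc hinv b hsum

end SequenceGerms

/-! ### The digamma function -/

section Gamma

open Topology Complex

theorem analyticAt_Gamma {s : ℂ} (hs : ∀ m : ℕ, s ≠ -m) : AnalyticAt ℂ Gamma s := by
  have h : AnalyticAt ℂ (fun s => (Gamma s)⁻¹) s :=
    (analyticOnNhd_univ_iff_differentiable.2 differentiable_one_div_Gamma) s (Set.mem_univ s)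
  simpa using h.fun_inv (inv_ne_zero (Gamma_ne_zero hs))

theorem analyticAt_logDeriv_Gamma {s : ℂ} (hs : ∀ m : ℕ, s ≠ -m) :
    AnalyticAt ℂ (logDeriv Gamma) s :=
  (analyticAt_Gamma hs).deriv.div (analyticAt_Gamma hs) (Gamma_ne_zero hs)

theorem logDeriv_Gamma_add_one {s : ℂ} (hs : ∀ m : ℕ, s ≠ -m) :
    logDeriv Gamma (s + 1) = logDeriv Gamma s + s⁻¹ := by
  have hs0 : s ≠ 0 := by simpa using hs 0
  have hd := (analyticAt_Gamma hs).differentiableAt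
  have e : (fun w => Gamma (w + 1)) =ᶠ[𝓝 s] fun w => w * Gamma w := by
    filter_upwards [isOpen_ne.mem_nhds hs0] with w hw
    exact Gamma_add_one w hw
  have h1 : deriv Gamma (s + 1) = Gamma s + s * deriv Gamma s := by
    rw [← deriv_comp_add_const, e.deriv_eq, deriv_fun_mul differentiableAt_fun_id hd]
    simp
  have hG := Gamma_ne_zero hs
  rw [logDeriv_apply, logDeriv_apply, h1, Gamma_add_one s hs0]
  field_simp
  ring

/-- Differentiate `ψ(w + 1) = ψ(w) + 1/w`, valid on the right half-plane, `i` times at `n + 1`. -/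
theorem iteratedDeriv_logDeriv_Gamma_add_one (i n : ℕ) :
    iteratedDeriv i (logDeriv Gamma) ((n : ℂ) + 1 + 1) =
      iteratedDeriv i (logDeriv Gamma) ((n : ℂ) + 1) +
        (-1) ^ i * i.factorial / ((n : ℂ) + 1) ^ (i + 1) := by
  have hre : {s : ℂ | 0 < s.re} ∈ 𝓝 ((n : ℂ) + 1) :=
    (isOpen_lt continuous_const continuous_re).mem_nhds (by simp; positivity)
  have hreg : ∀ s : ℂ, 0 < s.re → ∀ m : ℕ, s ≠ -m := by
    rintro s hs m rfl
    simp at hs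
    linarith [(Nat.cast_nonneg m : (0 : ℝ) ≤ m)]
  have e : (fun w => logDeriv Gamma (w + 1)) =ᶠ[𝓝 ((n : ℂ) + 1)]
      fun w => logDeriv Gamma w + w⁻¹ := by
    filter_upwards [hre] with w hw
    exact logDeriv_Gamma_add_one (hreg w hw)
  have hn : (n : ℂ) + 1 ≠ 0 := Nat.cast_add_one_ne_zero n
  have h1 := e.iteratedDeriv_eq i
  rw [iteratedDeriv_comp_add_const, iteratedDeriv_fun_add
    (analyticAt_logDeriv_Gamma (hreg _ (mem_of_mem_nhds (s := {s : ℂ | 0 < s.re}) hre))).contDiffAt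
    (contDiffAt_inv ℂ hn)] at h1
  have h2 : iteratedDeriv i (fun w : ℂ => w⁻¹) ((n : ℂ) + 1) =
      (-1) ^ i * i.factorial / ((n : ℂ) + 1) ^ (i + 1) := by
    rw [iteratedDeriv_eq_iterate]
    refine (iter_deriv_inv i _).trans ?_
    rw [div_eq_mul_inv, ← zpow_natCast ((n : ℂ) + 1) (i + 1), ← zpow_neg]
    congr 2
    push_cast
    ring
  exact h1.trans (congrArg _ h2)

/-- The logarithmic derivative of the Gamma function satisfies no algebraic differential equation
with constant coefficients near any regular point. -/
theorem not_eventually_eval_iteratedDeriv_logDeriv_Gamma_eq_zero {s : ℂ} (hs : ∀ m : ℕ, s ≠ -m)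
    {N : ℕ} {P : MvPolynomial (Fin N) ℂ} (hP : P ≠ 0) :
    ¬ ∀ᶠ w in 𝓝[≠] s,
      MvPolynomial.eval (fun i : Fin N => iteratedDeriv i (logDeriv Gamma) w) P = 0 := by
  intro h
  -- The complement of a countable set in the plane is connected, so the identity theorem carries
  -- the relation from `s` to every positive integer.
  set U : Set ℂ := (Set.range fun m : ℕ => (-m : ℂ))ᶜ
  have hmem : ∀ w, w ∈ U ↔ ∀ m : ℕ, w ≠ -m := fun w => by
    simp [U, eq_comm]
  have hU : IsPreconnected U :=
    ((Set.countable_range _).isConnected_compl_of_one_lt_rank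
      (by rw [rank_real_complex]; norm_num)).isPreconnected
  have hF : AnalyticOnNhd ℂ (fun w => MvPolynomial.aeval
      (fun i : Fin N => iteratedDeriv i (logDeriv Gamma) w) P) U :=
    AnalyticOnNhd.aeval_mvPolynomial (fun i => by
      have hL : AnalyticOnNhd ℂ (logDeriv Gamma) U := fun w hw =>
        analyticAt_logDeriv_Gamma ((hmem w).1 hw)
      simpa only [iteratedDeriv_eq_iterate] using hL.iterated_deriv i) P
  have hzero := hF.eqOn_zero_of_preconnected_of_frequently_eq_zero hU ((hmem s).2 hs)
    (Eventually.frequently h)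
  obtain ⟨n, hn⟩ := exists_eval_ne_zero_of_increments
    (y := fun (i : Fin N) (n : ℕ) => iteratedDeriv i (logDeriv Gamma) ((n : ℂ) + 1))
    (fun i n => by
      have := iteratedDeriv_logDeriv_Gamma_add_one i n
      push_cast
      exact this) hP
  refine hn (hzero ((hmem _).2 fun m hm => ?_))
  have : ((n + 1 + m : ℕ) : ℂ) = 0 := by push_cast; rw [hm]; ring
  exact absurd this (Nat.cast_ne_zero.2 (by omega))

end Gamma

/-! ### Conclusion -/

theorem eventually_nhdsNE_of_codiscreteWithin {U : Set ℂ} (hU : IsOpen U) {p : ℂ → Prop}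
    (h : ∀ᶠ z in codiscreteWithin U, p z) {z : ℂ} (hz : z ∈ U) :
    ∀ᶠ w in nhdsWithin z {z}ᶜ, p w := by
  filter_upwards [mem_codiscreteWithin_iff_forall_mem_nhdsNE.1 h z hz,
    mem_nhdsWithin_of_mem_nhds (hU.mem_nhds hz)] with w h1 h2
  exact h1.resolve_right fun h => h h2

open Topology MeromorphicGerm in
theorem mainTheorem2 (D : Set ℂ) (hDopen : IsOpen D) (hDconn : IsConnected D)
    (hDneg : D ⊆ negIntegersᶜ) (hDshift : (shiftOverlap D).Nonempty)
    (g : ℂ → ℂ) (hg : MeromorphicOn g D) (hsol : SolvesAltFactorialEq D g) :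
    ¬ SatisfiesADE D g := by
  rintro ⟨P, hP, hPg⟩
  obtain ⟨z, hz, hz'⟩ := hDshift
  -- `Γ` is regular at `z + 1`, since `z = -m - 1` would be a negative integer in `D`.
  have hreg : ∀ m : ℕ, z + 1 ≠ -m := fun m hm =>
    hDneg hz ⟨-m - 1, by omega, by push_cast; linear_combination hm⟩
  have hopen : IsOpen (shiftOverlap D) :=
    hDopen.inter (hDopen.preimage (continuous_id.sub continuous_const))
  have hshift : Tendsto (fun w : ℂ => w - 1) (𝓝[≠] z) (𝓝[≠] (z - 1)) :=
    tendsto_nhdsWithin_of_tendsto_nhds_of_eventually_within _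
      ((continuous_id.sub continuous_const).continuousAt.mono_left nhdsWithin_le_nhds)
      (by
        filter_upwards [self_mem_nhdsWithin] with w hw
        simpa using hw)
  have hu : MeromorphicAt (fun w => g (w - 0)) z := by simpa using hg z hz
  have hv : MeromorphicAt (fun w => g (w - 1)) z :=
    meromorphicAt_comp_sub_const_iff_meromorphicAt.2 (hg _ hz')
  have hG : MeromorphicAt (fun w => Complex.Gamma (w + 1)) z :=
    meromorphicAt_comp_add_const_iff_meromorphicAt.2 (Meromorphic.Gamma _)
  have hdu := isDifferentiallyAlgebraic_of hP hu
    (by simpa using eventually_nhdsNE_of_codiscreteWithin hDopen hPg hz)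
  have hdv := isDifferentiallyAlgebraic_of hP hv
    (hshift.eventually (eventually_nhdsNE_of_codiscreteWithin hDopen hPg hz'))
  have hsum : of _ hu + of _ hv = of _ hG := by
    rw [of_add_of, of_eq_of]
    filter_upwards [eventually_nhdsNE_of_codiscreteWithin hopen hsol ⟨hz, hz'⟩] with w hw
    simpa using hw
  obtain ⟨N, hN⟩ := hdu.exists_not_algebraicIndependent_logDeriv_add deriv_var hdv
  rw [hsum, deriv_of, of_div_of] at hN
  rw [algebraicIndependent_iff] at hN
  push Not at hN
  obtain ⟨Q, hQ, hQ0⟩ := hN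
  have hev := aeval_iterate_deriv_eq_zero _ hQ
  have hL : deriv (fun w => Complex.Gamma (w + 1)) / (fun w => Complex.Gamma (w + 1)) =
      fun w => logDeriv Complex.Gamma (w + 1) := by
    funext w
    simp [logDeriv_apply, deriv_comp_add_const]
  simp only [hL, iteratedDeriv_comp_add_const] at hev
  refine not_eventually_eval_iteratedDeriv_logDeriv_Gamma_eq_zero hreg hQ0 ?_
  -- The relation concerns `ψ(w + 1)` for `w` near `z`; substituting `w - 1` turns it into one for
  -- `ψ` near `z + 1`.
  have hshift' : Tendsto (fun w : ℂ => w - 1) (𝓝[≠] (z + 1)) (𝓝[≠] z) :=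
    tendsto_nhdsWithin_of_tendsto_nhds_of_eventually_within _
      (((continuous_id.sub continuous_const).tendsto' (z + 1) z (by simp)).mono_left
        nhdsWithin_le_nhds)
      (by
        filter_upwards [self_mem_nhdsWithin] with w hw
        simpa [sub_eq_iff_eq_add] using hw)
  simpa using hshift'.eventually hev
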